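/- Let $s>0$ and $\lambda>-1/2$ be real. Notation: - $(a)_0=1$, $(a)_k=a(a+1)\cdots(a+k-1)$ is the rising Pochhammer symbol. - ${}_2F_1(a,b;c;z)$, for real $z<1$, is the sum of the series $\sum_{k\ge0}\frac{(a)_k(b)_k}{(c)_k}\frac{z^k}{k!}$ when $|z|<1$, and its analytic continuation along the interval $(-\infty,1)$ otherwise. - For $\lambda\ne0$, the Gegenbauer polynomials $C_n^\lambda$ are given by $C_0^\lambda(t)=1$, $C_1^\lambda(t)=2\lambda t$ and $nC_n^\lambda(t)=2t(n+\lambda-1)C_{n-1}^\lambda(t)-(n+2\lambda-2)C_{n-2}^\lambda(t)$ for $n\ge2$. For $\lambda=0$, $C_n^0:=T_n$ is the Chebyshev polynomial of the first kind. - The modified mapped Gegenbauer functions are $R_n^\lambda(x)=(1+x^2)^{-\frac{\lambda+1}{2}}\,C_n^\lambda\!\big(\tfrac{x}{\sqrt{1+x^2}}\big)$ for $x\in\mathbb R$. - For $\lambda\neq0$, $a_n^\lambda=\frac{(\lambda)_n}{(1)_n}\frac{(\lambda+\frac12)_n}{(\frac12)_n}$ and $b_n^\lambda=\frac{2\lambda(\lambda+1)_n}{(1)_n}\frac{(\lambda+\frac12)_n}{(\frac32)_n}$.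 For $\lambda=0$, $a_n^0:=b_n^0:=1$. - $A_s^\gamma=\frac{2^{2s}\,\Gamma(s+\gamma)\,\Gamma(s+\frac12)}{\sqrt\pi\,\Gamma(\gamma)}$ for $\gamma>0$. - $(-\Delta)^su(x)=\mathscr F^{-1}\big[|\xi|^{2s}\mathscr F[u](\xi)\big](x)$ for $u\in L^2(\mathbb R)$ such that $|\xi|^{2s}\mathscr F[u](\xi)$ is integrable. Here $\mathscr F$ is the Fourier transform on $L^2(\mathbb R)$ that extends $\mathscr F[u](\xi)=\frac1{\sqrt{2\pi}}\int_{\mathbb R}u(x)e^{-ix\xi}\,dx$, and $\mathscr F^{-1}[g](x)=\frac1{\sqrt{2\pi}}\int_{\mathbb R}g(\xi)e^{ix\xi}\,d\xi$. Then, for every integer $n\ge0$, the fractional Laplacians of $R_{2n}^\lambda$ and $R_{2n+1}^\lambda$ are defined in this sense, and for every $x\in\mathbb R$ $$(-\Delta)^sR_{2n}^\lambda(x)=a_n^\lambda\sum_{k=0}^n\frac{(-n)_k(n+\lambda)_k}{(\lambda+\frac12)_k\,k!}\,A_s^{k+\frac{\lambda+1}2}\;{}_2F_1\Big(s+k+\tfrac{\lambda+1}2,\,s+\tfrac12;\,\tfrac12;\,-x^2\Big)$$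 and $$(-\Delta)^sR_{2n+1}^\lambda(x)=(2s+1)\,b_n^\lambda\,x\sum_{k=0}^n\frac{(-n)_k(n+\lambda+1)_k}{(\lambda+\frac12)_k\,k!}\,A_s^{k+\frac\lambda2+1}\;{}_2F_1\Big(s+k+\tfrac\lambda2+1,\,s+\tfrac32;\,\tfrac32;\,-x^2\Big).$$ -/

import Mathlib

open MeasureTheory FourierTransform

noncomputable section

/-- The rising Pochhammer symbol `(a)_k = a (a+1) ⋯ (a+k-1)`, with `(a)_0 = 1`. -/
def poch (a : ℝ) (k : ℕ) : ℝ := (ascPochhammer ℝ k).eval a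

/-- `F` is the real-analytic continuation to `(-∞, 1)` of the Gauss hypergeometric series
`∑ (a)_k (b)_k / (c)_k * z^k / k!`, which converges for `|z| < 1`. -/
def IsHypContinuation (a b c : ℝ) (F : ℝ → ℝ) : Prop :=
  AnalyticOnNhd ℝ F (Set.Iio 1) ∧ ∀ z : ℝ, |z| < 1 → F z = ordinaryHypergeometric a b c z

open Classical in
/-- The hypergeometric function `₂F₁(a, b; c; z)` for real `z < 1`: the power series for `|z| < 1`
and its analytic continuation elsewhere on `(-∞, 1)`. (The value is a default `0` if no
continuation existed; the continuation is unique, see `hyp2F1_eq`.) -/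
def hyp2F1 (a b c z : ℝ) : ℝ :=
  if h : ∃ F, IsHypContinuation a b c F then h.choose z else 0

theorem IsHypContinuation.unique {a b c : ℝ} {F G : ℝ → ℝ} (hF : IsHypContinuation a b c F)
    (hG : IsHypContinuation a b c G) {z : ℝ} (hz : z < 1) : F z = G z := by
  have h0 : (0 : ℝ) ∈ Set.Iio (1 : ℝ) := by simp
  refine hF.1.eqOn_of_preconnected_of_eventuallyEq hG.1 isPreconnected_Iio h0 ?_ hz
  filter_upwards [Metric.ball_mem_nhds (0 : ℝ) one_pos] with x hx
  have hx' : |x| < 1 := by simpa using hx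
  rw [hF.2 x hx', hG.2 x hx']

theorem hyp2F1_eq {a b c : ℝ} {F : ℝ → ℝ} (hF : IsHypContinuation a b c F) {z : ℝ} (hz : z < 1) :
    hyp2F1 a b c z = F z := by
  have h : ∃ F, IsHypContinuation a b c F := ⟨F, hF⟩
  rw [hyp2F1, dif_pos h]
  exact h.choose_spec.unique hF hz

/-- The polynomials generated by the three-term recurrence
`n C_n(t) = 2 t (n + lam - 1) C_{n-1}(t) - (n + 2 lam - 2) C_{n-2}(t)` for `n ≥ 2`,
with `C_0(t) = 1` and `C_1(t) = 2 lam t`. -/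
def gegenbauerRec (lam t : ℝ) : ℕ → ℝ
  | 0 => 1
  | 1 => 2 * lam * t
  | n + 2 =>
      (2 * t * (((n + 2 : ℕ) : ℝ) + lam - 1) * gegenbauerRec lam t (n + 1)
        - (((n + 2 : ℕ) : ℝ) + 2 * lam - 2) * gegenbauerRec lam t n) / ((n + 2 : ℕ) : ℝ)

open Classical in
/-- The Gegenbauer polynomial `C_n^lam(t)`. For `lam = 0`, where the recurrence degenerates,
`C_n^0` denotes the classical Chebyshev polynomial `T_n` of the first kind. -/
def gegenbauerC (lam : ℝ) (n : ℕ) (t : ℝ) : ℝ :=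
  if lam = 0 then (Polynomial.Chebyshev.T ℝ (n : ℤ)).eval t else gegenbauerRec lam t n

/-- The modified mapped Gegenbauer function `R_n^lam`. -/
def mmgf (lam : ℝ) (n : ℕ) (x : ℝ) : ℝ :=
  (1 + x ^ 2) ^ (-((lam + 1) / 2)) * gegenbauerC lam n (x / √(1 + x ^ 2))

open Classical in
/-- The constant `a_n^lam`. For `lam = 0` it is the one belonging to the normalization
`C_n^0 = T_n`, that is the limit of `(n / lam) a_n^lam` as `lam → 0` if `n ≥ 1`. -/
def coeffA (lam : ℝ) (n : ℕ) : ℝ :=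
  if lam = 0 then 1
  else poch lam n / poch 1 n * (poch (lam + 1 / 2) n / poch (1 / 2) n)

open Classical in
/-- The constant `b_n^lam`. For `lam = 0` it is the one belonging to the normalization
`C_n^0 = T_n`, that is the limit of `((2 n + 1) / (2 lam)) b_n^lam` as `lam → 0`. -/
def coeffB (lam : ℝ) (n : ℕ) : ℝ :=
  if lam = 0 then 1
  else 2 * lam * poch (lam + 1) n / poch 1 n * (poch (lam + 1 / 2) n / poch (3 / 2) n)

/-- The constant `A_s^γ`. -/
def constA (s γ : ℝ) : ℝ :=
  2 ^ (2 * s) * Real.Gamma (s + γ) * Real.Gamma (s + 1 / 2) / (√Real.pi * Real.Gamma γ)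

/-- `|ω|^{2s}` times the `L²` (Plancherel) Fourier transform of `u`. Mathlib's frequency variable
`ξ`, with kernel `exp (-2πi x ξ)`, corresponds to the angular frequency `ω = 2πξ`. -/
def fracSymbol (s : ℝ) {u : ℝ → ℂ} (hu : MemLp u 2 (volume : Measure ℝ)) (ξ : ℝ) : ℂ :=
  ((|2 * Real.pi * ξ| ^ (2 * s) : ℝ) : ℂ) * (𝓕 (hu.toLp u) : Lp ℂ 2 (volume : Measure ℝ)) ξ

/-- `(-Δ)^s u = v` pointwise on `ℝ`, where `(-Δ)^s u = 𝓕⁻¹ [|ω|^{2s} 𝓕 u]`: the function `u` is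
square integrable, `|ω|^{2s} 𝓕 u` is integrable (so that its inverse Fourier transform is an
absolutely convergent integral at every point), and this inverse transform equals `v`
everywhere. -/
def HasFracLaplacian (s : ℝ) (u v : ℝ → ℂ) : Prop :=
  ∃ hu : MemLp u 2 (volume : Measure ℝ),
    Integrable (fracSymbol s hu) ∧ ∀ x : ℝ, 𝓕⁻ (fracSymbol s hu) x = v x

end

/-! With t = x/√(1+x²) one has 1 - t² = (1+x²)⁻¹. Expanding a Gegenbauer polynomial in powers of 1 -
t², times t in odd degree, makes R_n a finite combination of profiles (1+x²)^(-γ) or x(1+x²)^(-γ)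
(`mmgf_even`, `mmgf_odd`), and linearity reduces the theorem to these profiles.

On the frequency side a profile is a Bessel weight, written as a mixture of Gaussians, so its
absolute moments are products of two Gamma values (`besselWeight_moment`). The factor |ω|^(2s) only
shifts the exponent. The inverse transform is thus a cosine or sine integral against a positive
measure with known moments. Termwise integration of the Taylor series gives ₂F₁ for 0 < x < 1;
exponential integrability makes the integral analytic in x on all of ℝ, hence equal to the
continuation (`integral_cos_of_even_moments`, `integral_sin_of_odd_moments`).

The same formula at s = 0 collapses to the binomial series and returns the profile, which certifies
the weight as its transform; `fourier_toLp_ae_eq` passes to the Plancherel transform. The bound λ >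
-1/2 makes every profile square integrable and keeps (λ+1/2)_k nonzero. -/

/-! ### Hypergeometric series and their continuation to the negative axis. -/

theorem analyticAt_rpow_comp {f : ℝ → ℝ} {x : ℝ} (hf : AnalyticAt ℝ f x) (hx : 0 < f x) (r : ℝ) :
    AnalyticAt ℝ (fun y => f y ^ r) x := by
  have h : AnalyticAt ℝ (fun y => Real.exp (Real.log (f y) * r)) x :=
    (((analyticAt_log hx).comp hf).mul analyticAt_const).rexp
  refine h.congr ?_
  filter_upwards [hf.continuousAt.eventually (lt_mem_nhds hx)] with y hy
  rw [Real.rpow_def_of_pos hy]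

theorem poch_pos {a : ℝ} (ha : 0 < a) (k : ℕ) : 0 < poch a k := ascPochhammer_pos k a ha

theorem poch_succ (a : ℝ) (k : ℕ) : poch a (k + 1) = poch a k * (a + k) :=
  ascPochhammer_succ_eval k a

theorem poch_zero (a : ℝ) : poch a 0 = 1 := by simp [poch]

theorem poch_succ_left (a : ℝ) (k : ℕ) : poch a (k + 1) = a * poch (a + 1) k := by
  induction k generalizing a with
  | zero => simp [poch_succ, poch_zero]
  | succ k ih => rw [poch_succ, ih, poch_succ (a + 1)]; push_cast; ring

theorem hypSeries_radius {a b c : ℝ} (ha : 0 < a) (hb : 0 < b) (hc : 0 < c) :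
    (ordinaryHypergeometricSeries ℝ a b c).radius = 1 := by
  refine ordinaryHypergeometricSeries_radius_eq_one ℝ a b c fun k => ?_
  have : (0 : ℝ) ≤ k := k.cast_nonneg
  refine ⟨?_, ?_, ?_⟩ <;> linarith

theorem mem_eball_zero_one {z : ℝ} (hz : |z| < 1) : z ∈ Metric.eball (0 : ℝ) 1 := by
  rw [← ENNReal.ofReal_one, Metric.eball_ofReal]
  simpa using hz

theorem hasFPowerSeriesOnBall_hyp {a b c : ℝ} (ha : 0 < a) (hb : 0 < b) (hc : 0 < c) :
    HasFPowerSeriesOnBall (ordinaryHypergeometric a b c : ℝ → ℝ)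
      (ordinaryHypergeometricSeries ℝ a b c) 0 1 := by
  have h := (ordinaryHypergeometricSeries ℝ a b c).hasFPowerSeriesOnBall
    (by rw [hypSeries_radius ha hb hc]; exact one_pos)
  rwa [hypSeries_radius ha hb hc] at h

theorem hasSum_hyp {a b c : ℝ} (ha : 0 < a) (hb : 0 < b) (hc : 0 < c) {z : ℝ} (hz : |z| < 1) :
    HasSum (fun k : ℕ => poch a k * poch b k / (poch c k * (k.factorial : ℝ)) * z ^ k)
      (ordinaryHypergeometric a b c z) := by
  have h := (hasFPowerSeriesOnBall_hyp ha hb hc).hasSum (mem_eball_zero_one hz)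
  rw [zero_add] at h
  refine (congrArg (HasSum · _) (funext fun k => ?_)).mpr h
  rw [ordinaryHypergeometricSeries_apply_eq]
  simp only [poch, smul_eq_mul]
  field_simp

theorem analyticOnNhd_hyp {a b c : ℝ} (ha : 0 < a) (hb : 0 < b) (hc : 0 < c) :
    ∀ z : ℝ, |z| < 1 → AnalyticAt ℝ (ordinaryHypergeometric a b c : ℝ → ℝ) z := fun _ hz =>
  (hasFPowerSeriesOnBall_hyp ha hb hc).analyticAt_of_mem (mem_eball_zero_one hz)

/-- A function of `x > 0` that is analytic and agrees with the hypergeometric series in `-x ^ 2`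
for small `x` provides the analytic continuation to the negative axis. -/
theorem isHypContinuation_of_analytic {a b c : ℝ} (ha : 0 < a) (hb : 0 < b) (hc : 0 < c)
    {G : ℝ → ℝ} (hG : AnalyticOnNhd ℝ G (Set.Ioi 0))
    (hs : ∀ x : ℝ, 0 < x → x < 1 → G x = ordinaryHypergeometric a b c (-x ^ 2)) :
    IsHypContinuation a b c
      (fun z => if z < 0 then G √(-z) else ordinaryHypergeometric a b c z) := by
  have key : ∀ z : ℝ, |z| < 1 →
      (if z < 0 then G √(-z) else ordinaryHypergeometric a b c z)
        = ordinaryHypergeometric a b c z := by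
    intro z hz
    split_ifs with h
    · rw [hs _ (Real.sqrt_pos.2 (by linarith)), Real.sq_sqrt (by linarith), neg_neg]
      rw [Real.sqrt_lt' one_pos]
      linarith [(abs_lt.1 hz).1]
    · rfl
  -- The two branches agree on (-1, 0), so near z = 0 the glued function is just the series.
  refine ⟨fun z hz => ?_, key⟩
  by_cases h : z < 0
  · have h1 : AnalyticAt ℝ (fun z : ℝ => √(-z)) z := by
      have : (fun z : ℝ => √(-z)) = fun z => (-z) ^ (1 / 2 : ℝ) := by
        ext w; rw [Real.sqrt_eq_rpow]
      rw [this]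
      exact analyticAt_rpow_comp analyticAt_id.neg (by simpa using h) _
    have h2 : AnalyticAt ℝ (fun z : ℝ => G √(-z)) z :=
      AnalyticAt.comp (g := G) (hG _ (Real.sqrt_pos.2 (by linarith))) h1
    refine h2.congr ?_
    filter_upwards [Iio_mem_nhds h] with w hw
    rw [if_pos (Set.mem_Iio.1 hw)]
  · have hz' : |z| < 1 := abs_lt.2 ⟨by linarith, hz⟩
    refine (analyticOnNhd_hyp ha hb hc z hz').congr ?_
    have : {w : ℝ | |w| < 1} ∈ nhds z :=
      (isOpen_lt continuous_abs continuous_const).mem_nhds hz'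
    filter_upwards [this] with w hw
    exact (key w hw).symm

theorem hyp2F1_neg_sq {a b c : ℝ} (ha : 0 < a) (hb : 0 < b) (hc : 0 < c)
    {G : ℝ → ℝ} (hG : AnalyticOnNhd ℝ G (Set.Ioi 0))
    (hs : ∀ x : ℝ, 0 < x → x < 1 → G x = ordinaryHypergeometric a b c (-x ^ 2)) :
    hyp2F1 a b c 0 = 1 ∧ ∀ x : ℝ, 0 < x → hyp2F1 a b c (-x ^ 2) = G x := by
  have h := isHypContinuation_of_analytic ha hb hc hG hs
  constructor
  · rw [hyp2F1_eq h one_pos]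
    simp
  · intro x hx
    have : -x ^ 2 < 0 := by have := pow_pos hx 2; linarith
    rw [hyp2F1_eq h (by linarith)]
    simp only [this, if_true, neg_neg, Real.sqrt_sq hx.le]

/-- The Pochhammer symbols of `b` cancel, leaving the binomial series. -/
theorem hyp2F1_self {a b z : ℝ} (hb : 0 < b) (hz : z < 1) :
    hyp2F1 a b b z = (1 - z) ^ (-a) := by
  refine hyp2F1_eq (F := fun z => (1 - z) ^ (-a)) ⟨fun w hw => ?_, fun w hw => ?_⟩ hz
  · exact analyticAt_rpow_comp (analyticAt_const.sub analyticAt_id) (by simpa using hw) _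
  · have h := (Real.one_add_rpow_hasFPowerSeriesOnBall_zero (a := -a)).hasSum
      (mem_eball_zero_one (z := -w) (by rwa [abs_neg]))
    rw [zero_add, ← sub_eq_add_neg, binomialSeries_eq_ordinaryHypergeometricSeries (b := b)
      (fun k => by have : (0 : ℝ) ≤ k := k.cast_nonneg
                   linarith)] at h
    change (1 - w) ^ (-a) = _
    rw [← h.tsum_eq, ordinaryHypergeometric, FormalMultilinearSeries.sum]
    refine tsum_congr fun k => ?_
    rw [FormalMultilinearSeries.compContinuousLinearMap_apply, neg_neg]
    congr 1
    ext i
    simp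

/-! ### Trigonometric integrals determined by moments. -/

section Moments

variable {Ω : Type*} [MeasurableSpace Ω] {μ : Measure Ω}

/-- Tonelli on the positive series (cosh, sinh) provides the domination that allows termwise
integration of the alternating one (cos, sin). -/
theorem integrable_hasSum_of_nonneg {f : ℕ → Ω → ℝ} {g h : Ω → ℝ} (hf : ∀ k ω, 0 ≤ f k ω)
    (hi : ∀ k, Integrable (f k) μ) (hS : Summable fun k => ∫ ω, f k ω ∂μ)
    (hgm : AEStronglyMeasurable g μ) (hg : ∀ ω, HasSum (fun k => f k ω) (g ω))
    (hh : ∀ ω, HasSum (fun k => (-1) ^ k * f k ω) (h ω)) :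
    Integrable g μ ∧ HasSum (fun k => (-1) ^ k * ∫ ω, f k ω ∂μ) (∫ ω, h ω ∂μ) := by
  constructor
  · refine ⟨hgm, ?_⟩
    have h0 : ∀ ω, 0 ≤ g ω := fun ω => (hg ω).nonneg fun k => hf k ω
    rw [hasFiniteIntegral_iff_ofReal (Filter.Eventually.of_forall h0)]
    have : ∀ ω, ENNReal.ofReal (g ω) = ∑' k, ENNReal.ofReal (f k ω) := fun ω => by
      rw [← (hg ω).tsum_eq, ENNReal.ofReal_tsum_of_nonneg (fun k => hf k ω) (hg ω).summable]
    simp_rw [this]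
    rw [lintegral_tsum fun k => (hi k).1.aemeasurable.ennreal_ofReal]
    have h2 : ∀ k, ∫⁻ ω, ENNReal.ofReal (f k ω) ∂μ = ENNReal.ofReal (∫ ω, f k ω ∂μ) := fun k =>
      (ofReal_integral_eq_lintegral_ofReal (hi k) (Filter.Eventually.of_forall (hf k))).symm
    simp_rw [h2]
    rw [← ENNReal.ofReal_tsum_of_nonneg (fun k => integral_nonneg (hf k)) hS]
    exact ENNReal.ofReal_lt_top
  · have := hasSum_integral_of_summable_integral_norm (μ := μ)
      (F := fun k ω => (-1) ^ k * f k ω) (fun k => (hi k).const_mul _) (by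
        simpa [abs_of_nonneg (hf _ _)] using hS)
    simp_rw [integral_const_mul, (hh _).tsum_eq] at this
    exact this

/-- The factorials in the cosine series supply the lower parameter 1/2 and absorb the 4^k of the
moments; in the sine series they supply 3/2. -/
theorem poch_half_mul (k : ℕ) :
    ((2 * k).factorial : ℝ) = 4 ^ k * (poch (1 / 2) k * (k.factorial : ℝ)) := by
  induction k with
  | zero => simp [poch_zero]
  | succ k ih =>
    rw [show 2 * (k + 1) = 2 * k + 1 + 1 by ring, Nat.factorial_succ, Nat.factorial_succ,
      Nat.factorial_succ, poch_succ]
    push_cast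
    rw [ih]
    ring

theorem poch_three_half_mul (k : ℕ) :
    ((2 * k + 1).factorial : ℝ) = 4 ^ k * (poch (3 / 2) k * (k.factorial : ℝ)) := by
  induction k with
  | zero => simp [poch_zero]
  | succ k ih =>
    rw [show 2 * (k + 1) + 1 = 2 * k + 1 + 1 + 1 by ring, Nat.factorial_succ (2 * k + 1 + 1),
      Nat.factorial_succ (2 * k + 1), Nat.factorial_succ k, poch_succ]
    push_cast
    rw [ih]
    ring

theorem neg_one_pow_mul_sq_lt_one {x : ℝ} (hx0 : 0 < x) (hx : x < 1) : |-x ^ 2| < 1 := by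
  rw [abs_neg, abs_of_nonneg (sq_nonneg x)]
  exact pow_lt_one₀ hx0.le hx two_ne_zero

theorem summable_hyp_sq {a b c : ℝ} (ha : 0 < a) (hb : 0 < b) (hc : 0 < c) {x : ℝ} (hx0 : 0 < x)
    (hx : x < 1) :
    Summable fun k : ℕ => poch a k * poch b k / (poch c k * (k.factorial : ℝ)) * (x ^ 2) ^ k := by
  refine (hasSum_hyp ha hb hc (z := x ^ 2) ?_).summable
  simpa using neg_one_pow_mul_sq_lt_one hx0 hx

theorem even_moments_series {X : Ω → ℝ} (hXm : Measurable X)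
    {a b C : ℝ} (ha : 0 < a) (hb : 0 < b)
    (hi : ∀ k : ℕ, Integrable (fun ω => X ω ^ (2 * k)) μ)
    (hM : ∀ k : ℕ, ∫ ω, X ω ^ (2 * k) ∂μ = C * 4 ^ k * poch a k * poch b k)
    {x : ℝ} (hx0 : 0 < x) (hx : x < 1) :
    Integrable (fun ω => Real.cosh (x * X ω)) μ ∧
      ∫ ω, Real.cos (x * X ω) ∂μ = C * ordinaryHypergeometric a b (1 / 2 : ℝ) (-x ^ 2) := by
  have hint : ∀ k : ℕ, ∫ ω, (x * X ω) ^ (2 * k) / ((2 * k).factorial : ℝ) ∂μ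
      = C * (poch a k * poch b k / (poch (1 / 2) k * (k.factorial : ℝ)) * (x ^ 2) ^ k) := by
    intro k
    have h1 := (poch_pos (a := 1 / 2) (by norm_num) k).ne'
    simp_rw [mul_pow, integral_div, integral_const_mul, hM, poch_half_mul, pow_mul]
    field_simp
  have hS := summable_hyp_sq ha hb (c := 1 / 2) (by norm_num) hx0 hx
  have key := integrable_hasSum_of_nonneg (μ := μ)
    (f := fun k ω => (x * X ω) ^ (2 * k) / ((2 * k).factorial : ℝ))
    (g := fun ω => Real.cosh (x * X ω)) (h := fun ω => Real.cos (x * X ω))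
    (fun k ω => div_nonneg ((even_two_mul k).pow_nonneg _) (Nat.cast_nonneg _))
    (fun k => by simp_rw [mul_pow]; exact ((hi k).const_mul _).div_const _)
    (by simp_rw [hint]; exact hS.mul_left C)
    (by fun_prop) (fun ω => Real.hasSum_cosh _)
    (fun ω => by simpa only [mul_div_assoc] using Real.hasSum_cos (x * X ω))
  refine ⟨key.1, key.2.unique ?_⟩
  have h := (hasSum_hyp ha hb (c := 1 / 2) (by norm_num)
    (neg_one_pow_mul_sq_lt_one hx0 hx)).mul_left C
  refine (congrArg (HasSum · _) (funext fun k => ?_)).mpr h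
  rw [hint, neg_pow (x ^ 2)]
  ring

theorem odd_moments_series {X : Ω → ℝ} (hX : ∀ ω, 0 ≤ X ω) (hXm : Measurable X)
    {a b C : ℝ} (ha : 0 < a) (hb : 0 < b)
    (hi : ∀ k : ℕ, Integrable (fun ω => X ω ^ (2 * k + 1)) μ)
    (hM : ∀ k : ℕ, ∫ ω, X ω ^ (2 * k + 1) ∂μ = C * 4 ^ k * poch a k * poch b k)
    {x : ℝ} (hx0 : 0 < x) (hx : x < 1) :
    Integrable (fun ω => Real.sinh (x * X ω)) μ ∧
      ∫ ω, Real.sin (x * X ω) ∂μ = C * x * ordinaryHypergeometric a b (3 / 2 : ℝ) (-x ^ 2) := by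
  have hint : ∀ k : ℕ, ∫ ω, (x * X ω) ^ (2 * k + 1) / ((2 * k + 1).factorial : ℝ) ∂μ
      = C * x * (poch a k * poch b k / (poch (3 / 2) k * (k.factorial : ℝ)) * (x ^ 2) ^ k) := by
    intro k
    have h1 := (poch_pos (a := 3 / 2) (by norm_num) k).ne'
    simp_rw [mul_pow, integral_div, integral_const_mul, hM, poch_three_half_mul, pow_succ x (2 * k),
      pow_mul]
    field_simp
  have hS := summable_hyp_sq ha hb (c := 3 / 2) (by norm_num) hx0 hx
  have key := integrable_hasSum_of_nonneg (μ := μ)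
    (f := fun k ω => (x * X ω) ^ (2 * k + 1) / ((2 * k + 1).factorial : ℝ))
    (g := fun ω => Real.sinh (x * X ω)) (h := fun ω => Real.sin (x * X ω))
    (fun k ω => div_nonneg (pow_nonneg (mul_nonneg hx0.le (hX ω)) _) (Nat.cast_nonneg _))
    (fun k => by simp_rw [mul_pow]; exact ((hi k).const_mul _).div_const _)
    (by simp_rw [hint]; exact hS.mul_left (C * x))
    (by fun_prop) (fun ω => Real.hasSum_sinh _)
    (fun ω => by simpa only [mul_div_assoc] using Real.hasSum_sin (x * X ω))
  refine ⟨key.1, key.2.unique ?_⟩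
  have h := (hasSum_hyp ha hb (c := 3 / 2) (by norm_num)
    (neg_one_pow_mul_sq_lt_one hx0 hx)).mul_left (C * x)
  refine (congrArg (HasSum · _) (funext fun k => ?_)).mpr h
  rw [hint, neg_pow (x ^ 2)]
  ring

/-- Exponential integrability makes the trigonometric integrals of `X` analytic. -/
theorem analyticOnNhd_integral_cos_sin [IsFiniteMeasure μ] {X : Ω → ℝ} (hX : ∀ ω, 0 ≤ X ω)
    (hXm : Measurable X) {r : ℝ} (hr : 0 < r) (hi : Integrable (fun ω => Real.exp (r * X ω)) μ) :
    AnalyticOnNhd ℝ (fun x : ℝ => ∫ ω, Real.cos (x * X ω) ∂μ) Set.univ ∧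
      AnalyticOnNhd ℝ (fun x : ℝ => ∫ ω, Real.sin (x * X ω) ∂μ) Set.univ := by
  have h0 : (0 : ℝ) ∈ interior (ProbabilityTheory.integrableExpSet X μ) := by
    rw [mem_interior_iff_mem_nhds]
    -- Since X ≥ 0, integrability at `r` passes to every y < r, a neighbourhood of 0.
    filter_upwards [Iio_mem_nhds hr] with y hy
    refine hi.mono' (by fun_prop) (Filter.Eventually.of_forall fun ω => ?_)
    rw [Real.norm_eq_abs, abs_of_pos (Real.exp_pos _)]
    exact Real.exp_le_exp.2 (mul_le_mul_of_nonneg_right (le_of_lt hy) (hX ω))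
  -- The strip of analyticity of `complexMGF` contains the imaginary axis, where its real and
  -- imaginary parts are the cosine and sine integrals.
  have han : ∀ x : ℝ, AnalyticAt ℝ
      (fun x : ℝ => ProbabilityTheory.complexMGF X μ (x * Complex.I)) x := by
    intro x
    have h1 : AnalyticAt ℝ (ProbabilityTheory.complexMGF X μ) ((x : ℂ) * Complex.I) :=
      (ProbabilityTheory.analyticAt_complexMGF (by simpa using h0)).restrictScalars
    have h2 : AnalyticAt ℝ (fun x : ℝ => (x : ℂ) * Complex.I) x :=
      (Complex.ofRealCLM.analyticAt x).mul analyticAt_const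
    exact AnalyticAt.comp (g := ProbabilityTheory.complexMGF X μ) h1 h2
  have hint : ∀ x : ℝ, Integrable (fun ω => Complex.exp (x * Complex.I * X ω)) μ := by
    intro x
    refine (integrable_const (1 : ℝ)).mono' (by fun_prop) (Filter.Eventually.of_forall fun ω => ?_)
    rw [show (x : ℂ) * Complex.I * X ω = ((x * X ω : ℝ) : ℂ) * Complex.I by push_cast; ring,
      Complex.norm_exp_ofReal_mul_I]
  constructor
  · intro x _
    refine ((Complex.reCLM.analyticAt _).comp (han x)).congr
      (Filter.Eventually.of_forall fun y => ?_)
    simp only [Function.comp, ProbabilityTheory.complexMGF]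
    rw [← ContinuousLinearMap.integral_comp_comm _ (hint y)]
    refine integral_congr_ae (Filter.Eventually.of_forall fun ω => ?_)
    simp only [Complex.reCLM_apply]
    rw [show (y : ℂ) * Complex.I * X ω = ((y * X ω : ℝ) : ℂ) * Complex.I by push_cast; ring,
      Complex.exp_ofReal_mul_I_re]
  · intro x _
    refine ((Complex.imCLM.analyticAt _).comp (han x)).congr
      (Filter.Eventually.of_forall fun y => ?_)
    simp only [Function.comp, ProbabilityTheory.complexMGF]
    rw [← ContinuousLinearMap.integral_comp_comm _ (hint y)]
    refine integral_congr_ae (Filter.Eventually.of_forall fun ω => ?_)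
    simp only [Complex.imCLM_apply]
    rw [show (y : ℂ) * Complex.I * X ω = ((y * X ω : ℝ) : ℂ) * Complex.I by push_cast; ring,
      Complex.exp_ofReal_mul_I_im]

theorem integral_cos_of_even_moments [IsFiniteMeasure μ] {X : Ω → ℝ} (hX : ∀ ω, 0 ≤ X ω)
    (hXm : Measurable X) {a b C : ℝ} (ha : 0 < a) (hb : 0 < b) (hC : C ≠ 0)
    (hi : ∀ k : ℕ, Integrable (fun ω => X ω ^ (2 * k)) μ)
    (hM : ∀ k : ℕ, ∫ ω, X ω ^ (2 * k) ∂μ = C * 4 ^ k * poch a k * poch b k) (x : ℝ) :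
    ∫ ω, Real.cos (x * X ω) ∂μ = C * hyp2F1 a b (1 / 2) (-x ^ 2) := by
  have hser := fun (y : ℝ) (hy0 : 0 < y) (hy : y < 1) =>
    even_moments_series hXm ha hb hi hM hy0 hy
  -- Use exp ≤ 2 cosh; any point of (0, 1) would do in place of 1/2.
  have hexp : Integrable (fun ω => Real.exp (1 / 2 * X ω)) μ := by
    refine ((hser (1 / 2) (by norm_num) (by norm_num)).1.const_mul 2).mono' (by fun_prop)
      (Filter.Eventually.of_forall fun ω => ?_)
    rw [Real.norm_eq_abs, abs_of_pos (Real.exp_pos _), Real.cosh_eq]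
    linarith [Real.exp_pos (-(1 / 2 * X ω))]
  have han := (analyticOnNhd_integral_cos_sin hX hXm (by norm_num) hexp).1
  have key := hyp2F1_neg_sq ha hb (c := 1 / 2) (by norm_num)
    (G := fun x => C⁻¹ * ∫ ω, Real.cos (x * X ω) ∂μ)
    (fun y _ => analyticAt_const.mul (han y trivial)) (fun y hy0 hy => by
      simp only [(hser y hy0 hy).2]; field_simp)
  rcases lt_trichotomy x 0 with h | h | h
  · have := key.2 (-x) (by linarith)
    rw [neg_sq] at this
    rw [this, mul_inv_cancel_left₀ hC]
    simp
  -- At x = 0 the zeroth moment says that `C` is the total mass.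
  · subst h
    have := hM 0
    simp [poch_zero] at this
    rw [zero_pow two_ne_zero, neg_zero, key.1]
    simpa using this
  · rw [key.2 x h, mul_inv_cancel_left₀ hC]

theorem integral_sin_of_odd_moments [IsFiniteMeasure μ] {X : Ω → ℝ} (hX : ∀ ω, 0 ≤ X ω)
    (hXm : Measurable X) {a b C : ℝ} (ha : 0 < a) (hb : 0 < b) (hC : C ≠ 0)
    (hi : ∀ k : ℕ, Integrable (fun ω => X ω ^ (2 * k + 1)) μ)
    (hM : ∀ k : ℕ, ∫ ω, X ω ^ (2 * k + 1) ∂μ = C * 4 ^ k * poch a k * poch b k) (x : ℝ) :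
    ∫ ω, Real.sin (x * X ω) ∂μ = C * x * hyp2F1 a b (3 / 2) (-x ^ 2) := by
  have hser := fun (y : ℝ) (hy0 : 0 < y) (hy : y < 1) =>
    odd_moments_series hX hXm ha hb hi hM hy0 hy
  have hexp : Integrable (fun ω => Real.exp (1 / 2 * X ω)) μ := by
    refine (((hser (1 / 2) (by norm_num) (by norm_num)).1.const_mul 2).add
      (integrable_const (1 : ℝ))).mono' (by fun_prop)
      (Filter.Eventually.of_forall fun ω => ?_)
    rw [Real.norm_eq_abs, abs_of_pos (Real.exp_pos _), Pi.add_apply, Real.sinh_eq]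
    have : Real.exp (-(1 / 2 * X ω)) ≤ 1 := Real.exp_le_one_iff.2 (by linarith [hX ω])
    linarith
  have han := (analyticOnNhd_integral_cos_sin hX hXm (by norm_num) hexp).2
  -- The sine integral must be divided by x, which is why the continuation argument works only on x
  -- > 0.
  have key := hyp2F1_neg_sq ha hb (c := 3 / 2) (by norm_num)
    (G := fun x => C⁻¹ * x⁻¹ * ∫ ω, Real.sin (x * X ω) ∂μ)
    (fun y hy => (analyticAt_const.mul (analyticAt_id.inv (ne_of_gt hy))).mul (han y trivial))
    (fun y hy0 hy => by
      simp only [(hser y hy0 hy).2]; field_simp)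
  rcases lt_trichotomy x 0 with h | h | h
  · have := key.2 (-x) (by linarith)
    rw [neg_sq] at this
    rw [this]
    simp only [neg_mul, Real.sin_neg, integral_neg]
    have hx := h.ne
    field_simp
  · simp [h]
  · rw [key.2 x h]
    field_simp

end Moments

/-! ### Moments of the Bessel weight. -/

theorem Gamma_add_natCast {a : ℝ} (ha : 0 < a) (k : ℕ) :
    Real.Gamma (a + k) = poch a k * Real.Gamma a := by
  induction k with
  | zero => simp [poch_zero]
  | succ k ih =>
    rw [Nat.cast_succ, ← add_assoc, Real.Gamma_add_one (by positivity), ih, poch_succ]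
    ring

theorem integral_abs_rpow_mul_exp_neg_mul_sq {p b : ℝ} (hp : -1 < p) (hb : 0 < b) :
    Integrable (fun ξ : ℝ => |ξ| ^ p * Real.exp (-b * ξ ^ 2)) ∧
      ∫ ξ : ℝ, |ξ| ^ p * Real.exp (-b * ξ ^ 2)
        = b ^ (-(p + 1) / 2) * Real.Gamma ((p + 1) / 2) := by
  constructor
  · have h := (integrable_rpow_mul_exp_neg_mul_sq hb hp)
    have h2 : IntegrableOn (fun ξ : ℝ => |ξ| ^ p * Real.exp (-b * |ξ| ^ 2)) (Set.Ioi 0) :=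
      h.integrableOn.congr_fun (fun ξ hξ => by simp only [abs_of_pos (Set.mem_Ioi.1 hξ)])
        measurableSet_Ioi
    simp only [sq_abs] at h2
    have h3 : IntegrableOn (fun ξ : ℝ => |ξ| ^ p * Real.exp (-b * ξ ^ 2)) (Set.Iic 0) := by
      have m : MeasurableEmbedding (Neg.neg : ℝ → ℝ) := (Homeomorph.neg ℝ).measurableEmbedding
      rw [← Measure.map_neg_eq_self (volume : Measure ℝ), m.integrableOn_map_iff]
      simpa [Function.comp_def, integrableOn_Ici_iff_integrableOn_Ioi] using h2
    rw [← integrableOn_univ, ← Set.Iic_union_Ioi (a := (0 : ℝ))]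
    exact h3.union h2
  · have h := integral_comp_abs (f := fun ξ : ℝ => ξ ^ p * Real.exp (-b * ξ ^ 2))
    simp only [sq_abs] at h
    rw [h]
    have := integral_rpow_mul_exp_neg_mul_rpow (p := 2) two_pos hp hb
    simp only [Real.rpow_two] at this
    rw [this]
    ring

/-- The function `ξ ↦ 2 (π |ξ|) ^ q K_q(2 π |ξ|)`, with `K_q` the modified Bessel function, in its
integral representation. -/
noncomputable def besselWeight (q ξ : ℝ) : ℝ :=
  ∫ t in Set.Ioi (0 : ℝ), t ^ (q - 1) * Real.exp (-t) * Real.exp (-(Real.pi ^ 2 / t) * ξ ^ 2)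

theorem besselWeight_nonneg (q ξ : ℝ) : 0 ≤ besselWeight q ξ :=
  setIntegral_nonneg measurableSet_Ioi fun t ht => by
    have : 0 < t := ht
    positivity

theorem besselWeight_neg (q ξ : ℝ) : besselWeight q (-ξ) = besselWeight q ξ := by
  simp [besselWeight]

theorem measurable_besselWeight (q : ℝ) : Measurable (besselWeight q) := by
  have h : StronglyMeasurable (fun z : ℝ × ℝ =>
      z.2 ^ (q - 1) * Real.exp (-z.2) * Real.exp (-(Real.pi ^ 2 / z.2) * z.1 ^ 2)) :=
    Measurable.stronglyMeasurable (by fun_prop)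
  exact (h.integral_prod_right (ν := volume.restrict (Set.Ioi (0 : ℝ)))).measurable

/-- Swapping integrals, the Gaussian moment in ξ gives Γ((p+1)/2) and a factor t^((p+1)/2); the
remaining t-integral is Γ(q+(p+1)/2). For q ≤ 0 the integral defining `besselWeight` diverges at ξ =
0 and defaults to 0, at a null point only. -/
theorem besselWeight_moment {p q : ℝ} (hp : -1 < p) (hq : 0 < q + (p + 1) / 2) :
    Integrable (fun ξ : ℝ => |2 * Real.pi * ξ| ^ p * besselWeight q ξ) ∧
      ∫ ξ : ℝ, |2 * Real.pi * ξ| ^ p * besselWeight q ξ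
        = 2 ^ p / Real.pi * Real.Gamma ((p + 1) / 2) * Real.Gamma (q + (p + 1) / 2) := by
  have hπ := Real.pi_pos
  set F : ℝ × ℝ → ℝ := fun z => |2 * Real.pi * z.1| ^ p *
    (z.2 ^ (q - 1) * Real.exp (-z.2) * Real.exp (-(Real.pi ^ 2 / z.2) * z.1 ^ 2)) with hF
  set ν : Measure ℝ := volume.restrict (Set.Ioi (0 : ℝ)) with hν
  have hFm : AEStronglyMeasurable F (volume.prod ν) :=
    Measurable.aestronglyMeasurable (by fun_prop)
  have hFt : ∀ t : ℝ, (fun ξ => F (ξ, t)) = fun ξ => ((2 * Real.pi) ^ p * (t ^ (q - 1) *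
      Real.exp (-t))) * (|ξ| ^ p * Real.exp (-(Real.pi ^ 2 / t) * ξ ^ 2)) := by
    intro t
    ext ξ
    simp only [hF]
    rw [abs_mul, abs_of_pos (by positivity : 0 < 2 * Real.pi),
      Real.mul_rpow (by positivity) (abs_nonneg ξ)]
    ring
  have hinner : ∀ t : ℝ, 0 < t → Integrable (fun ξ => F (ξ, t)) ∧
      ∫ ξ, F (ξ, t) = 2 ^ p / Real.pi * Real.Gamma ((p + 1) / 2) *
        (t ^ (q + (p + 1) / 2 - 1) * Real.exp (-(1 * t))) := by
    intro t ht
    have h := integral_abs_rpow_mul_exp_neg_mul_sq (b := Real.pi ^ 2 / t) hp (by positivity)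
    rw [hFt]
    refine ⟨h.1.const_mul _, ?_⟩
    rw [integral_const_mul, h.2, Real.div_rpow (by positivity) ht.le,
      Real.mul_rpow (by positivity) hπ.le, ← Real.rpow_natCast, ← Real.rpow_mul hπ.le,
      show q + (p + 1) / 2 - 1 = (q - 1) + (p + 1) / 2 by ring, Real.rpow_add ht,
      show -(p + 1) / 2 = -((p + 1) / 2) by ring, Real.rpow_neg ht.le,
      show ((2 : ℕ) : ℝ) * -((p + 1) / 2) = -p - 1 by push_cast; ring, Real.rpow_sub hπ,
      Real.rpow_neg hπ.le, Real.rpow_one, one_mul]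
    have h1 : Real.pi ^ p ≠ 0 := (Real.rpow_pos_of_pos hπ p).ne'
    field_simp
  have hFnn : ∀ ξ t : ℝ, 0 < t → 0 ≤ F (ξ, t) := fun ξ t ht => by
    simp only [hF]; positivity
  have hGamma : IntegrableOn
      (fun t : ℝ => t ^ (q + (p + 1) / 2 - 1) * Real.exp (-(1 * t))) (Set.Ioi 0) := by
    refine (Real.GammaIntegral_convergent hq).congr_fun (fun t _ => ?_) measurableSet_Ioi
    rw [one_mul, mul_comm]
  have hint : Integrable F (volume.prod ν) := by
    rw [integrable_prod_iff' hFm]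
    constructor
    · exact (ae_restrict_mem measurableSet_Ioi).mono fun t ht => (hinner t ht).1
    · refine (hGamma.const_mul (2 ^ p / Real.pi * Real.Gamma ((p + 1) / 2))).congr ?_
      filter_upwards [ae_restrict_mem measurableSet_Ioi] with t ht
      rw [← (hinner t ht).2]
      exact integral_congr_ae (Filter.Eventually.of_forall fun ξ => by
        simp only [Real.norm_eq_abs, abs_of_nonneg (hFnn ξ t ht)])
  have heq : ∀ ξ, |2 * Real.pi * ξ| ^ p * besselWeight q ξ = ∫ t, F (ξ, t) ∂ν := fun ξ => by
    rw [besselWeight, ← integral_const_mul]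
  simp_rw [heq]
  refine ⟨hint.integral_prod_left, ?_⟩
  rw [← integral_prod _ hint, integral_prod_symm _ hint,
    setIntegral_congr_fun measurableSet_Ioi (fun t ht => (hinner t ht).2), integral_const_mul,
    Real.integral_rpow_mul_exp_neg_mul_Ioi hq one_pos]
  simp

/-- The measure on frequency space with density `K |2 π ξ| ^ p` times the Bessel weight. -/
noncomputable def besselMeasure (K p q : ℝ) : Measure ℝ :=
  volume.withDensity fun ξ => ENNReal.ofReal (K * |2 * Real.pi * ξ| ^ p * besselWeight q ξ)

theorem measurable_besselDensity (K p q : ℝ) : Measurable fun ξ =>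
    ENNReal.ofReal (K * |2 * Real.pi * ξ| ^ p * besselWeight q ξ) := by
  have := measurable_besselWeight q
  fun_prop

theorem integral_besselMeasure {K p q : ℝ} (hK : 0 ≤ K) (f : ℝ → ℝ) :
    ∫ ξ, f ξ ∂besselMeasure K p q
      = ∫ ξ, K * |2 * Real.pi * ξ| ^ p * besselWeight q ξ * f ξ := by
  rw [besselMeasure, integral_withDensity_eq_integral_toReal_smul (measurable_besselDensity K p q)
    (Filter.Eventually.of_forall fun _ => ENNReal.ofReal_lt_top)]
  refine integral_congr_ae (Filter.Eventually.of_forall fun ξ => ?_)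
  have := besselWeight_nonneg q ξ
  simp only [smul_eq_mul]
  rw [ENNReal.toReal_ofReal (by positivity)]

theorem besselMeasure_moment {K p q : ℝ} (hK : 0 ≤ K) (hp : -1 < p) (hq : 0 < q + (p + 1) / 2)
    (j : ℕ) :
    Integrable (fun ξ => |2 * Real.pi * ξ| ^ j) (besselMeasure K p q) ∧
      ∫ ξ, |2 * Real.pi * ξ| ^ j ∂besselMeasure K p q
        = K * (2 ^ (p + j) / Real.pi * Real.Gamma ((p + j + 1) / 2)
          * Real.Gamma (q + (p + j + 1) / 2)) := by
  have hj : (0 : ℝ) ≤ j := j.cast_nonneg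
  have hM := besselWeight_moment (p := p + j) (q := q) (by linarith) (by linarith)
  have hae : (fun ξ : ℝ => K * (|2 * Real.pi * ξ| ^ (p + j) * besselWeight q ξ)) =ᵐ[volume]
      fun ξ => K * |2 * Real.pi * ξ| ^ p * besselWeight q ξ * |2 * Real.pi * ξ| ^ j := by
    filter_upwards [compl_mem_ae_iff.2 (measure_singleton (0 : ℝ))] with ξ hξ
    have hξ' : ξ ≠ 0 := hξ
    rw [Real.rpow_add (by positivity), Real.rpow_natCast]
    ring
  constructor
  · rw [besselMeasure, integrable_withDensity_iff_integrable_smul' (measurable_besselDensity K p q)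
      (Filter.Eventually.of_forall fun _ => ENNReal.ofReal_lt_top)]
    refine (hM.1.const_mul K).congr (hae.trans (Filter.Eventually.of_forall fun ξ => ?_))
    have := besselWeight_nonneg q ξ
    simp only [smul_eq_mul]
    rw [ENNReal.toReal_ofReal (by positivity)]
  · rw [integral_besselMeasure hK, ← integral_congr_ae hae, integral_const_mul, hM.2]

theorem isFiniteMeasure_besselMeasure {K p q : ℝ} (hK : 0 ≤ K) (hp : -1 < p)
    (hq : 0 < q + (p + 1) / 2) : IsFiniteMeasure (besselMeasure K p q) := by
  have h := (besselMeasure_moment hK hp hq 0).1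
  simp only [pow_zero] at h
  exact (integrable_const_iff_isFiniteMeasure one_ne_zero).1 h

/-! ### Inverse Fourier transforms of the spectra. -/

theorem integral_eq_zero_of_odd {f : ℝ → ℝ} (hf : ∀ x, f (-x) = -f x) : ∫ x, f x = 0 := by
  have h := integral_neg_eq_self f volume
  simp_rw [hf, integral_neg] at h
  linarith

theorem fourierInv_ofReal {w : ℝ → ℝ} (hw : Integrable w) (x : ℝ) :
    𝓕⁻ (fun ξ => (w ξ : ℂ)) x = ((∫ ξ, Real.cos (2 * Real.pi * (ξ * x)) * w ξ : ℝ) : ℂ)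
      + ((∫ ξ, Real.sin (2 * Real.pi * (ξ * x)) * w ξ : ℝ) : ℂ) * Complex.I := by
  have h1 : Integrable fun ξ => Real.cos (2 * Real.pi * (ξ * x)) * w ξ :=
    hw.bdd_mul (c := 1) (by fun_prop)
      (Filter.Eventually.of_forall fun ξ => Real.abs_cos_le_one _)
  have h2 : Integrable fun ξ => Real.sin (2 * Real.pi * (ξ * x)) * w ξ :=
    hw.bdd_mul (c := 1) (by fun_prop)
      (Filter.Eventually.of_forall fun ξ => Real.abs_sin_le_one _)
  rw [Real.fourierInv_eq', ← integral_complex_ofReal, ← integral_complex_ofReal,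
    ← integral_mul_const, ← integral_add h1.ofReal (h2.ofReal.mul_const _)]
  refine integral_congr_ae (Filter.Eventually.of_forall fun ξ => ?_)
  simp only [smul_eq_mul, RCLike.inner_apply, conj_trivial]
  rw [Complex.exp_mul_I, mul_comm x ξ, ← Complex.ofReal_cos, ← Complex.ofReal_sin]
  push_cast
  ring

theorem fourierInv_even {w : ℝ → ℝ} (hw : Integrable w) (he : ∀ ξ, w (-ξ) = w ξ) (x : ℝ) :
    𝓕⁻ (fun ξ => (w ξ : ℂ)) x
      = ((∫ ξ, w ξ * Real.cos (x * |2 * Real.pi * ξ|) : ℝ) : ℂ) := by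
  rw [fourierInv_ofReal hw, integral_eq_zero_of_odd
    (f := fun ξ => Real.sin (2 * Real.pi * (ξ * x)) * w ξ)
    (fun ξ => by rw [he, neg_mul, mul_neg, Real.sin_neg]; ring)]
  simp only [Complex.ofReal_zero, zero_mul, add_zero]
  congr 2
  ext ξ
  rw [mul_comm]
  congr 1
  rcases abs_choice (2 * Real.pi * ξ) with h | h <;> rw [h]
  · ring_nf
  · rw [← Real.cos_neg]; ring_nf

theorem fourierInv_odd {w : ℝ → ℝ} (hw : Integrable fun ξ => 2 * Real.pi * ξ * w ξ)
    (he : ∀ ξ, w (-ξ) = w ξ) (x : ℝ) :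
    𝓕⁻ (fun ξ => -Complex.I * ((2 * Real.pi * ξ * w ξ : ℝ) : ℂ)) x
      = ((∫ ξ, |2 * Real.pi * ξ| * w ξ * Real.sin (x * |2 * Real.pi * ξ|) : ℝ) : ℂ) := by
  have h := fourierInv_ofReal hw x
  rw [integral_eq_zero_of_odd
    (f := fun ξ => Real.cos (2 * Real.pi * (ξ * x)) * (2 * Real.pi * ξ * w ξ))
    (fun ξ => by rw [he, neg_mul, mul_neg, Real.cos_neg]; ring)] at h
  have h2 : 𝓕⁻ (fun ξ => -Complex.I * ((2 * Real.pi * ξ * w ξ : ℝ) : ℂ)) x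
      = -Complex.I * 𝓕⁻ (fun ξ => ((2 * Real.pi * ξ * w ξ : ℝ) : ℂ)) x := by
    rw [Real.fourierInv_eq', Real.fourierInv_eq', ← integral_const_mul]
    refine integral_congr_ae (Filter.Eventually.of_forall fun ξ => ?_)
    simp only [smul_eq_mul]
    ring
  rw [h2, h]
  have h3 : ∀ z : ℂ, -Complex.I * (((0 : ℝ) : ℂ) + z * Complex.I) = z := fun z => by
    linear_combination (-z) * Complex.I_mul_I - Complex.I * Complex.ofReal_zero
  rw [h3]
  congr 2
  ext ξ
  rcases abs_choice (2 * Real.pi * ξ) with h | h <;> rw [h]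
  · rw [show 2 * Real.pi * (ξ * x) = x * (2 * Real.pi * ξ) by ring]; ring
  · rw [show x * -(2 * Real.pi * ξ) = -(2 * Real.pi * (ξ * x)) by ring, Real.sin_neg]; ring

/-- The Fourier transform of `(1 + x ^ 2) ^ (-γ)`. -/
noncomputable def evenSpectrum (γ ξ : ℝ) : ℝ :=
  √Real.pi / Real.Gamma γ * besselWeight (γ - 1 / 2) ξ

/-- Up to the factor `-i`, the Fourier transform of `x * (1 + x ^ 2) ^ (-γ)`. -/
noncomputable def oddSpectrum (γ ξ : ℝ) : ℝ :=
  2 * Real.pi * ξ * (√Real.pi / (2 * Real.Gamma γ) * besselWeight (γ - 3 / 2) ξ)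

theorem constA_pos {s γ : ℝ} (hs : 0 ≤ s) (hγ : 0 < γ) : 0 < constA s γ := by
  have h1 := Real.Gamma_pos_of_pos hγ
  have h2 := Real.Gamma_pos_of_pos (add_pos_of_nonneg_of_pos hs hγ)
  have h3 : 0 < Real.Gamma (s + 1 / 2) := Real.Gamma_pos_of_pos (by linarith)
  have := Real.pi_pos
  unfold constA
  positivity

theorem constA_zero {γ : ℝ} (hγ : 0 < γ) : constA 0 γ = 1 := by
  have h1 := (Real.Gamma_pos_of_pos hγ).ne'
  have h2 : √Real.pi ≠ 0 := (Real.sqrt_pos.2 Real.pi_pos).ne'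
  simp only [constA, mul_zero, Real.rpow_zero, zero_add, Real.Gamma_one_half_eq]
  field_simp

theorem rpow_two_mul_add (s : ℝ) (k : ℕ) : (2 : ℝ) ^ (2 * s + (2 * k : ℕ)) = 2 ^ (2 * s) * 4 ^ k := by
  rw [Real.rpow_add two_pos, Real.rpow_natCast, pow_mul]
  norm_num

/-- The moment of order 2k carries Γ(s+γ+k) Γ(s+1/2+k), whose Pochhammer parts are the upper
parameters and whose value at k = 0 gives `constA`. -/
theorem evenSpectrum_transform {s γ : ℝ} (hs : 0 ≤ s) (hγ : 0 < γ) :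
    Integrable (fun ξ : ℝ => |2 * Real.pi * ξ| ^ (2 * s) * evenSpectrum γ ξ) ∧
      ∀ x : ℝ, 𝓕⁻ (fun ξ : ℝ => ((|2 * Real.pi * ξ| ^ (2 * s) * evenSpectrum γ ξ : ℝ) : ℂ)) x
        = ((constA s γ * hyp2F1 (s + γ) (s + 1 / 2) (1 / 2) (-x ^ 2) : ℝ) : ℂ) := by
  have hπ := Real.pi_pos
  have hΓ := Real.Gamma_pos_of_pos hγ
  set K := √Real.pi / Real.Gamma γ with hKdef
  have hK : 0 ≤ K := by positivity
  have hw : (fun ξ : ℝ => |2 * Real.pi * ξ| ^ (2 * s) * evenSpectrum γ ξ) =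
      fun ξ => K * |2 * Real.pi * ξ| ^ (2 * s) * besselWeight (γ - 1 / 2) ξ := by
    ext ξ; rw [evenSpectrum]; ring
  have hp : -1 < 2 * s := by linarith
  have hq : 0 < γ - 1 / 2 + (2 * s + 1) / 2 := by linarith
  have hint : Integrable (fun ξ : ℝ => |2 * Real.pi * ξ| ^ (2 * s) * evenSpectrum γ ξ) := by
    rw [hw]
    simpa only [mul_assoc] using (besselWeight_moment hp hq).1.const_mul K
  refine ⟨hint, fun x => ?_⟩
  rw [fourierInv_even hint (fun ξ => by simp [evenSpectrum, besselWeight_neg])]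
  have := isFiniteMeasure_besselMeasure hK hp hq
  have key := integral_cos_of_even_moments (μ := besselMeasure K (2 * s) (γ - 1 / 2))
    (X := fun ξ => |2 * Real.pi * ξ|) (fun ξ => abs_nonneg _) (by fun_prop)
    (a := s + γ) (b := s + 1 / 2) (C := constA s γ) (by linarith) (by linarith)
    (constA_pos hs hγ).ne' (fun k => (besselMeasure_moment hK hp hq (2 * k)).1) (fun k => by
      rw [(besselMeasure_moment hK hp hq (2 * k)).2, rpow_two_mul_add,
        show γ - 1 / 2 + (2 * s + (2 * k : ℕ) + 1) / 2 = (s + γ) + k by push_cast; ring,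
        show (2 * s + (2 * k : ℕ) + 1) / 2 = (s + 1 / 2) + k by push_cast; ring,
        Gamma_add_natCast (by linarith), Gamma_add_natCast (by linarith), hKdef, constA]
      have h1 := Real.sq_sqrt hπ.le
      have h2 : √Real.pi ≠ 0 := (Real.sqrt_pos.2 hπ).ne'
      field_simp
      rw [h1]) x
  rw [← key, integral_besselMeasure hK]
  simp_rw [← congrFun hw]

/-- The extra factor |ω| shifts p to 2s + 1. The moments of order 2k + 1 carry Γ(s+3/2+k), and
Γ(s+3/2) = (s+1/2) Γ(s+1/2) produces the factor 2s + 1. -/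
theorem oddSpectrum_transform {s γ : ℝ} (hs : 0 ≤ s) (hγ : 1 / 2 < γ) :
    Integrable (fun ξ : ℝ => |2 * Real.pi * ξ| ^ (2 * s) * oddSpectrum γ ξ) ∧
      ∀ x : ℝ, 𝓕⁻ (fun ξ : ℝ => -Complex.I *
          ((|2 * Real.pi * ξ| ^ (2 * s) * oddSpectrum γ ξ : ℝ) : ℂ)) x
        = (((2 * s + 1) * constA s γ * x
          * hyp2F1 (s + γ) (s + 3 / 2) (3 / 2) (-x ^ 2) : ℝ) : ℂ) := by
  have hπ := Real.pi_pos
  have hγ0 : 0 < γ := by linarith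
  have hΓ := Real.Gamma_pos_of_pos hγ0
  set K := √Real.pi / (2 * Real.Gamma γ) with hKdef
  have hK : 0 ≤ K := by positivity
  set w : ℝ → ℝ := fun ξ => |2 * Real.pi * ξ| ^ (2 * s) * (K * besselWeight (γ - 3 / 2) ξ) with hw
  have hwo : ∀ ξ : ℝ, |2 * Real.pi * ξ| ^ (2 * s) * oddSpectrum γ ξ = 2 * Real.pi * ξ * w ξ := by
    intro ξ; rw [oddSpectrum, hw]; ring
  have hp : -1 < 2 * s + 1 := by linarith
  have hq : 0 < γ - 3 / 2 + (2 * s + 1 + 1) / 2 := by linarith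
  have habs : ∀ ξ : ℝ, K * |2 * Real.pi * ξ| ^ (2 * s + 1) * besselWeight (γ - 3 / 2) ξ
      = |2 * Real.pi * ξ| * w ξ := by
    intro ξ
    rw [Real.rpow_add_one' (abs_nonneg _) (by linarith), hw]
    ring
  have hint : Integrable fun ξ => 2 * Real.pi * ξ * w ξ := by
    have h := (besselWeight_moment hp hq).1.const_mul K
    simp_rw [← mul_assoc, habs] at h
    refine h.mono ?_ (Filter.Eventually.of_forall fun ξ => ?_)
    · have := measurable_besselWeight (γ - 3 / 2)
      exact Measurable.aestronglyMeasurable (by fun_prop)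
    · simp [abs_mul]
  simp_rw [hwo]
  refine ⟨hint, fun x => ?_⟩
  rw [fourierInv_odd hint (fun ξ => by simp [hw, besselWeight_neg])]
  have := isFiniteMeasure_besselMeasure hK hp hq
  have hA := constA_pos hs hγ0
  have key := integral_sin_of_odd_moments (μ := besselMeasure K (2 * s + 1) (γ - 3 / 2))
    (X := fun ξ => |2 * Real.pi * ξ|) (fun ξ => abs_nonneg _) (by fun_prop)
    (a := s + γ) (b := s + 3 / 2) (C := (2 * s + 1) * constA s γ) (by linarith) (by linarith)
    (by positivity) (fun k => (besselMeasure_moment hK hp hq (2 * k + 1)).1) (fun k => by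
      rw [(besselMeasure_moment hK hp hq (2 * k + 1)).2,
        show 2 * s + 1 + (2 * k + 1 : ℕ) = 2 * s + (2 * k : ℕ) + 2 by push_cast; ring,
        show γ - 3 / 2 + (2 * s + (2 * k : ℕ) + 2 + 1) / 2 = (s + γ) + k by push_cast; ring,
        show (2 * s + (2 * k : ℕ) + 2 + 1) / 2 = (s + 3 / 2) + k by push_cast; ring,
        Real.rpow_add two_pos, rpow_two_mul_add, Real.rpow_two,
        Gamma_add_natCast (by linarith), Gamma_add_natCast (by linarith), hKdef, constA,
        show s + 3 / 2 = s + 1 / 2 + 1 by ring, Real.Gamma_add_one (by linarith)]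
      have h1 := Real.sq_sqrt hπ.le
      have h2 : √Real.pi ≠ 0 := (Real.sqrt_pos.2 hπ).ne'
      field_simp
      rw [h1]) x
  rw [← key, integral_besselMeasure hK]
  simp_rw [habs]

/-- At s = 0 the parameters 1/2 cancel and `constA` is 1. -/
theorem fourierInv_evenSpectrum {γ : ℝ} (hγ : 0 < γ) :
    Integrable (evenSpectrum γ) ∧
      ∀ x : ℝ, 𝓕⁻ (fun ξ : ℝ => (evenSpectrum γ ξ : ℂ)) x = (((1 + x ^ 2) ^ (-γ) : ℝ) : ℂ) := by
  have h := evenSpectrum_transform le_rfl hγ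
  simp only [mul_zero, Real.rpow_zero, one_mul, constA_zero hγ, zero_add] at h
  refine ⟨h.1, fun x => ?_⟩
  rw [h.2, hyp2F1_self (by norm_num) (by linarith [sq_nonneg x]), sub_neg_eq_add]

theorem fourierInv_oddSpectrum {γ : ℝ} (hγ : 1 / 2 < γ) :
    Integrable (oddSpectrum γ) ∧
      ∀ x : ℝ, 𝓕⁻ (fun ξ : ℝ => -Complex.I * (oddSpectrum γ ξ : ℂ)) x
        = ((x * (1 + x ^ 2) ^ (-γ) : ℝ) : ℂ) := by
  have h := oddSpectrum_transform le_rfl hγ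
  simp only [mul_zero, Real.rpow_zero, one_mul, constA_zero (by linarith : 0 < γ), zero_add] at h
  refine ⟨h.1, fun x => ?_⟩
  rw [h.2, hyp2F1_self (by norm_num) (by linarith [sq_nonneg x]), sub_neg_eq_add]

/-! ### Plancherel transform and linearity. -/

theorem integral_fourier_smul_eq_of_integrable {f g : ℝ → ℂ} (hf : Integrable f)
    (hg : Integrable g) : ∫ ξ, 𝓕 f ξ • g ξ = ∫ x, f x • 𝓕 g x := by
  simpa using! VectorFourier.integral_fourierIntegral_smul_eq_flip (L := innerₗ ℝ)
    (μ := (volume : Measure ℝ)) (ν := (volume : Measure ℝ))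
    Real.continuous_fourierChar continuous_inner hf hg

/-- If `u` is square integrable and the inverse Fourier transform of an integrable `g`, then `g` is
the Plancherel transform of `u`. -/
theorem fourier_toLp_ae_eq {g u : ℝ → ℂ} (hg : Integrable g) (hgu : ∀ x, 𝓕⁻ g x = u x)
    (hu : MemLp u 2 (volume : Measure ℝ)) :
    ((𝓕 (hu.toLp u) : Lp ℂ 2 (volume : Measure ℝ)) : ℝ → ℂ) =ᵐ[volume] g := by
  -- Both sides are tested against smooth compactly supported φ: the L² transform is moved onto φ as
  -- a tempered distribution, then the multiplication formula moves it on to `g`.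
  refine ae_eq_of_integral_contDiff_smul_eq
    ((Lp.memLp _).locallyIntegrable one_le_two) hg.locallyIntegrable fun φ hφ hφc => ?_
  have hψc : HasCompactSupport fun x => (φ x : ℂ) := hφc.comp_left Complex.ofReal_zero
  have hψ : ContDiff ℝ (⊤ : ℕ∞) fun x => (φ x : ℂ) := Complex.ofRealCLM.contDiff.comp hφ
  set ψ : SchwartzMap ℝ ℂ := hψc.toSchwartzMap hψ
  have hψa : ∀ x, ψ x = (φ x : ℂ) := fun x => rfl
  have h := DFunLike.congr_fun (Lp.fourier_toTemperedDistribution_eq (hu.toLp u)) ψ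
  rw [TemperedDistribution.fourier_apply, Lp.toTemperedDistribution_apply,
    Lp.toTemperedDistribution_apply] at h
  have h1 : ∀ f : ℝ → ℂ, ∫ x, φ x • f x = ∫ x, ψ x • f x := fun f =>
    integral_congr_ae (Filter.Eventually.of_forall fun x => by simp [hψa])
  rw [h1, h1, ← h]
  have h2 : ∫ x, (𝓕 ψ) x • (hu.toLp u : ℝ → ℂ) x = ∫ x, (𝓕 ψ) x • 𝓕⁻ g x := by
    refine integral_congr_ae ?_
    filter_upwards [hu.coeFn_toLp] with x hx
    rw [hx, hgu]
  rw [h2]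
  have h4 : ∀ x, 𝓕⁻ ((𝓕 ψ : SchwartzMap ℝ ℂ) : ℝ → ℂ) x = ψ x := fun x => by
    rw [← SchwartzMap.fourierInv_coe, FourierTransform.fourierInv_fourier_eq]
  calc ∫ x, (𝓕 ψ) x • 𝓕⁻ g x
      = ∫ x, (𝓕 ψ) x • 𝓕 (fun y => g (-y)) x := by
        rw [Real.fourierInv_eq_fourier_comp_neg]
    _ = ∫ ξ, 𝓕 ((𝓕 ψ : SchwartzMap ℝ ℂ) : ℝ → ℂ) ξ • g (-ξ) :=
        (integral_fourier_smul_eq_of_integrable (𝓕 ψ).integrable hg.comp_neg).symm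
    _ = ∫ ξ, ψ ξ • g ξ := by
        rw [← integral_neg_eq_self]
        simp_rw [neg_neg, ← Real.fourierInv_eq_fourier_neg, h4]

/-- A form of `HasFracLaplacian` in which `u` is given as the inverse Fourier transform of an
integrable function. -/
def HasL1FracLaplacian (s : ℝ) (u v : ℝ → ℂ) : Prop :=
  ∃ g : ℝ → ℂ, Integrable g ∧ (∀ x, 𝓕⁻ g x = u x) ∧ MemLp u 2 (volume : Measure ℝ) ∧
    Integrable (fun ξ : ℝ => ((|2 * Real.pi * ξ| ^ (2 * s) : ℝ) : ℂ) * g ξ) ∧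
    ∀ x : ℝ, 𝓕⁻ (fun ξ : ℝ => ((|2 * Real.pi * ξ| ^ (2 * s) : ℝ) : ℂ) * g ξ) x = v x

theorem fourierInv_congr_ae {f g : ℝ → ℂ} (h : f =ᵐ[volume] g) (x : ℝ) : 𝓕⁻ f x = 𝓕⁻ g x := by
  rw [Real.fourierInv_eq', Real.fourierInv_eq']
  refine integral_congr_ae ?_
  filter_upwards [h] with ξ hξ
  rw [hξ]

theorem fourierInv_const_mul (f : ℝ → ℂ) (c : ℂ) (x : ℝ) :
    𝓕⁻ (fun ξ => c * f ξ) x = c * 𝓕⁻ f x := by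
  rw [Real.fourierInv_eq', Real.fourierInv_eq', ← integral_const_mul]
  refine integral_congr_ae (Filter.Eventually.of_forall fun ξ => ?_)
  simp only [smul_eq_mul]
  ring

theorem fourierInv_add_of_integrable {f g : ℝ → ℂ} (hf : Integrable f) (hg : Integrable g) (x : ℝ) :
    𝓕⁻ (fun ξ => f ξ + g ξ) x = 𝓕⁻ f x + 𝓕⁻ g x := by
  have h : ∀ f : ℝ → ℂ, Integrable f →
      Integrable fun v : ℝ => Complex.exp (↑(2 * Real.pi * inner ℝ v x) * Complex.I) • f v := by
    intro f hf
    refine hf.bdd_mul (c := 1) (Measurable.aestronglyMeasurable (by fun_prop))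
      (Filter.Eventually.of_forall fun ξ => ?_)
    rw [Complex.norm_exp_ofReal_mul_I]
  rw [Real.fourierInv_eq', Real.fourierInv_eq', Real.fourierInv_eq', ← integral_add (h f hf) (h g hg)]
  simp_rw [smul_add]

namespace HasL1FracLaplacian

variable {s : ℝ} {u v u' v' : ℝ → ℂ}

theorem hasFracLaplacian (h : HasL1FracLaplacian s u v) : HasFracLaplacian s u v := by
  obtain ⟨g, hg, hgu, hu, hi, hv⟩ := h
  have hae : fracSymbol s hu =ᵐ[volume]
      fun ξ : ℝ => ((|2 * Real.pi * ξ| ^ (2 * s) : ℝ) : ℂ) * g ξ := by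
    filter_upwards [fourier_toLp_ae_eq hg hgu hu] with ξ hξ
    rw [fracSymbol, hξ]
  exact ⟨hu, hi.congr hae.symm, fun x => by rw [fourierInv_congr_ae hae, hv]⟩

theorem zero : HasL1FracLaplacian s (fun _ => 0) (fun _ => 0) :=
  ⟨fun _ => 0, by simp, fun x => by simp [Real.fourierInv_eq'], MemLp.zero', by simp,
    fun x => by simp [Real.fourierInv_eq']⟩

theorem add (h : HasL1FracLaplacian s u v) (h' : HasL1FracLaplacian s u' v') :
    HasL1FracLaplacian s (fun x => u x + u' x) (fun x => v x + v' x) := by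
  obtain ⟨g, hg, hgu, hu, hi, hv⟩ := h
  obtain ⟨g', hg', hgu', hu', hi', hv'⟩ := h'
  refine ⟨fun ξ => g ξ + g' ξ, hg.add hg', fun x => ?_, hu.add hu', ?_, fun x => ?_⟩
  · rw [fourierInv_add_of_integrable hg hg', hgu, hgu']
  · simp_rw [mul_add]
    exact hi.add hi'
  · simp_rw [mul_add]
    rw [fourierInv_add_of_integrable hi hi', hv, hv']

theorem const_mul (h : HasL1FracLaplacian s u v) (c : ℂ) :
    HasL1FracLaplacian s (fun x => c * u x) (fun x => c * v x) := by
  obtain ⟨g, hg, hgu, hu, hi, hv⟩ := h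
  refine ⟨fun ξ => c * g ξ, hg.const_mul c, fun x => ?_, hu.const_mul c, ?_, fun x => ?_⟩
  · rw [fourierInv_const_mul, hgu]
  · simp_rw [mul_left_comm _ c]
    exact hi.const_mul c
  · simp_rw [mul_left_comm _ c]
    rw [fourierInv_const_mul, hv]

theorem sum {ι : Type*} (S : Finset ι) {u v : ι → ℝ → ℂ}
    (h : ∀ i ∈ S, HasL1FracLaplacian s (u i) (v i)) :
    HasL1FracLaplacian s (fun x => ∑ i ∈ S, u i x) (fun x => ∑ i ∈ S, v i x) := by
  classical
  induction S using Finset.induction_on with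
  | empty => simpa using zero
  | insert i S hi ih =>
    simp_rw [Finset.sum_insert hi]
    exact (h i (Finset.mem_insert_self i S)).add
      (ih fun j hj => h j (Finset.mem_insert_of_mem hj))

end HasL1FracLaplacian

/-! ### Fractional Laplacians of the two profiles. -/

theorem memLp_two_one_add_sq_rpow {γ : ℝ} (hγ : 1 / 4 < γ) :
    MemLp (fun x : ℝ => (((1 + x ^ 2) ^ (-γ) : ℝ) : ℂ)) 2 (volume : Measure ℝ) := by
  rw [memLp_two_iff_integrable_sq_norm (Measurable.aestronglyMeasurable (by fun_prop))]
  -- The squared profile is (1+x²)^(-r/2) with r = 4γ, integrable as r > 1.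
  have h := integrable_rpow_neg_one_add_norm_sq (E := ℝ) (μ := volume) (r := 4 * γ)
    (by simp; linarith)
  refine h.congr (Filter.Eventually.of_forall fun x => ?_)
  have hx : 0 < 1 + x ^ 2 := by positivity
  simp only [Complex.norm_real, Real.norm_eq_abs, sq_abs]
  rw [← Real.rpow_mul_natCast hx.le]
  congr 1
  push_cast
  ring

theorem hasL1FracLaplacian_even {s γ : ℝ} (hs : 0 ≤ s) (hγ : 1 / 4 < γ) :
    HasL1FracLaplacian s (fun x => (((1 + x ^ 2) ^ (-γ) : ℝ) : ℂ))
      (fun x => ((constA s γ * hyp2F1 (s + γ) (s + 1 / 2) (1 / 2) (-x ^ 2) : ℝ) : ℂ)) := by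
  have hγ0 : 0 < γ := by linarith
  have h0 := fourierInv_evenSpectrum hγ0
  have h1 := evenSpectrum_transform hs hγ0
  refine ⟨fun ξ => (evenSpectrum γ ξ : ℂ), h0.1.ofReal, h0.2, memLp_two_one_add_sq_rpow hγ, ?_, ?_⟩
  · simp_rw [← Complex.ofReal_mul]
    exact h1.1.ofReal
  · simp_rw [← Complex.ofReal_mul]
    exact h1.2

theorem hasL1FracLaplacian_odd {s γ : ℝ} (hs : 0 ≤ s) (hγ : 3 / 4 < γ) :
    HasL1FracLaplacian s (fun x => ((x * (1 + x ^ 2) ^ (-γ) : ℝ) : ℂ))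
      (fun x => (((2 * s + 1) * constA s γ * x
          * hyp2F1 (s + γ) (s + 3 / 2) (3 / 2) (-x ^ 2) : ℝ) : ℂ)) := by
  have hγ0 : 1 / 2 < γ := by linarith
  have h0 := fourierInv_oddSpectrum hγ0
  have h1 := oddSpectrum_transform hs hγ0
  refine ⟨fun ξ => -Complex.I * (oddSpectrum γ ξ : ℂ), h0.1.ofReal.const_mul _, h0.2, ?_, ?_, ?_⟩
  -- As |x| ≤ √(1+x²), the odd profile is dominated by the even one of exponent γ - 1/2.
  · refine (memLp_two_one_add_sq_rpow (γ := γ - 1 / 2) (by linarith)).mono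
      (Measurable.aestronglyMeasurable (by fun_prop)) (Filter.Eventually.of_forall fun x => ?_)
    have hx : 0 < 1 + x ^ 2 := by positivity
    rw [Complex.norm_real, Complex.norm_real, Real.norm_eq_abs, Real.norm_eq_abs, abs_mul,
      abs_of_pos (Real.rpow_pos_of_pos hx _), abs_of_pos (Real.rpow_pos_of_pos hx _),
      show -(γ - 1 / 2) = 1 / 2 + -γ by ring, Real.rpow_add hx, ← Real.sqrt_eq_rpow]
    exact mul_le_mul_of_nonneg_right (Real.abs_le_sqrt (by linarith))
      (Real.rpow_nonneg hx.le _)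
  · simp_rw [mul_left_comm _ (-Complex.I), ← Complex.ofReal_mul]
    exact h1.1.ofReal.const_mul _
  · simp_rw [mul_left_comm _ (-Complex.I), ← Complex.ofReal_mul]
    exact h1.2

/-! ### Gegenbauer polynomials in powers of 1 - t². -/

theorem poch_neg_natCast_eq_zero {n k : ℕ} (h : n < k) : poch (-(n : ℝ)) k = 0 := by
  rw [poch, ascPochhammer_eval_eq_zero_iff]
  exact ⟨n, h, by simp⟩

/-- The coefficients `(-n)_k (n + lam + δ)_k / ((lam + 1/2)_k k!)` of the normalized Gegenbauer
polynomials in powers of `1 - t ^ 2`; the parity of the degree enters through `δ ∈ {0, 1}`. -/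
noncomputable def gegenCoeff (lam δ : ℝ) (n k : ℕ) : ℝ :=
  poch (-(n : ℝ)) k * poch (n + lam + δ) k / (poch (lam + 1 / 2) k * (k.factorial : ℝ))

/-- The terminating hypergeometric sum in `y = 1 - t ^ 2`. -/
noncomputable def gegenSum (lam δ : ℝ) (n : ℕ) (y : ℝ) : ℝ :=
  ∑ k ∈ Finset.range (n + 1), gegenCoeff lam δ n k * y ^ k

theorem gegenCoeff_eq_zero {lam δ : ℝ} {n k : ℕ} (h : n < k) : gegenCoeff lam δ n k = 0 := by
  rw [gegenCoeff, poch_neg_natCast_eq_zero h]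
  simp

theorem gegenSum_eq_sum_range {lam δ : ℝ} {n N : ℕ} (h : n < N) (y : ℝ) :
    gegenSum lam δ n y = ∑ k ∈ Finset.range N, gegenCoeff lam δ n k * y ^ k := by
  refine Finset.sum_subset (Finset.range_mono h) fun k _ hk => ?_
  rw [gegenCoeff_eq_zero (by simpa using hk), zero_mul]

theorem gegenSum_zero (lam δ y : ℝ) : gegenSum lam δ 0 y = 1 := by
  simp [gegenSum, gegenCoeff, poch_zero]

/-- Normalized to 1 at t = 1, the polynomials satisfy (m+2λ)P_{m+1} = 2t(m+λ)P_m - mP_{m-1}, which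
at λ = 0, m ≥ 1 is the Chebyshev recurrence. This is m = 2n + 2, with the common factor t removed.
-/
theorem gegenCoeff_odd_recurrence (lam : ℝ) (n k : ℕ) :
    (2 * (n + 1 : ℕ) + 2 * lam) * gegenCoeff lam 1 (n + 1) k
      = 2 * (2 * (n + 1 : ℕ) + lam) * gegenCoeff lam 0 (n + 1) k
        - 2 * (n + 1 : ℕ) * gegenCoeff lam 1 n k := by
  have h1 : (((n + 1 : ℕ) : ℝ) + lam) * poch ((n + 1 : ℕ) + lam + 1) k
      = poch ((n + 1 : ℕ) + lam) k * ((n + 1 : ℕ) + lam + k) := by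
    rw [← poch_succ_left, poch_succ]
  have h2 : (-((n + 1 : ℕ) : ℝ)) * poch (-(n : ℝ)) k
      = poch (-((n + 1 : ℕ) : ℝ)) k * (-((n + 1 : ℕ) : ℝ) + k) := by
    rw [← poch_succ, poch_succ_left]
    congr 2
    push_cast
    ring
  simp only [gegenCoeff]
  rw [show (n : ℝ) + lam + 1 = (n + 1 : ℕ) + lam by push_cast; ring, add_zero,
    ← mul_div_assoc, ← mul_div_assoc, ← mul_div_assoc, ← sub_div]
  congr 1
  linear_combination 2 * poch (-((n + 1 : ℕ) : ℝ)) k * h1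
    - 2 * poch ((n + 1 : ℕ) + lam) k * h2

theorem gegenCoeff_even_recurrence_zero (lam : ℝ) (n : ℕ) :
    (2 * (n : ℝ) + 1 + 2 * lam) * gegenCoeff lam 0 (n + 1) 0
      = 2 * (2 * n + 1 + lam) * gegenCoeff lam 1 n 0 - (2 * n + 1) * gegenCoeff lam 0 n 0 := by
  simp only [gegenCoeff, poch_zero]
  norm_num
  ring

/-- The case m = 2n + 1; the difference of coefficients comes from t² = 1 - y. -/
theorem gegenCoeff_even_recurrence {lam : ℝ} (hlam : -(1 / 2) < lam) (n k : ℕ) :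
    (2 * (n : ℝ) + 1 + 2 * lam) * gegenCoeff lam 0 (n + 1) (k + 1)
      = 2 * (2 * n + 1 + lam) * (gegenCoeff lam 1 n (k + 1) - gegenCoeff lam 1 n k)
        - (2 * n + 1) * gegenCoeff lam 0 n (k + 1) := by
  have hk : (poch (lam + 1 / 2) k) ≠ 0 := (poch_pos (by linarith) k).ne'
  have hk' : lam + 1 / 2 + k ≠ 0 := by
    have : (0 : ℝ) ≤ k := k.cast_nonneg
    linarith
  have hf : (k.factorial : ℝ) ≠ 0 := by positivity
  have hk1 : (k : ℝ) + 1 ≠ 0 := by positivity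
  simp only [gegenCoeff, add_zero]
  rw [poch_succ_left (-((n + 1 : ℕ) : ℝ)), poch_succ (((n + 1 : ℕ) : ℝ) + lam),
    poch_succ (-(n : ℝ)), poch_succ ((n : ℝ) + lam + 1), poch_succ_left ((n : ℝ) + lam),
    poch_succ (lam + 1 / 2), Nat.factorial_succ,
    show -((n + 1 : ℕ) : ℝ) + 1 = -n by push_cast; ring,
    show ((n + 1 : ℕ) : ℝ) + lam = n + lam + 1 by push_cast; ring]
  push_cast
  generalize poch (lam + 1 / 2) k = D at *
  have hk2 : 2 * lam + 1 + 2 * k ≠ 0 := by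
    intro h; apply hk'; linarith
  field_simp
  ring

theorem gegenSum_odd_recurrence (lam : ℝ) (n : ℕ) (y : ℝ) :
    (2 * (n + 1 : ℕ) + 2 * lam) * gegenSum lam 1 (n + 1) y
      = 2 * (2 * (n + 1 : ℕ) + lam) * gegenSum lam 0 (n + 1) y
        - 2 * (n + 1 : ℕ) * gegenSum lam 1 n y := by
  rw [gegenSum_eq_sum_range (N := n + 2) (by lia) (n := n), gegenSum, gegenSum, Finset.mul_sum,
    Finset.mul_sum, Finset.mul_sum, ← Finset.sum_sub_distrib]
  refine Finset.sum_congr rfl fun k _ => ?_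
  linear_combination y ^ k * gegenCoeff_odd_recurrence lam n k

theorem gegenSum_even_recurrence {lam : ℝ} (hlam : -(1 / 2) < lam) (n : ℕ) (y : ℝ) :
    (2 * (n : ℝ) + 1 + 2 * lam) * gegenSum lam 0 (n + 1) y
      = 2 * (2 * n + 1 + lam) * (1 - y) * gegenSum lam 1 n y
        - (2 * n + 1) * gegenSum lam 0 n y := by
  have h1 : (1 - y) * gegenSum lam 1 n y = gegenCoeff lam 1 n 0
      + ∑ k ∈ Finset.range (n + 1),
        (gegenCoeff lam 1 n (k + 1) - gegenCoeff lam 1 n k) * y ^ (k + 1) := by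
    rw [sub_mul, one_mul]
    -- Only the unshifted copy is padded by a zero term, so that it matches the copy multiplied by
    -- y.
    nth_rw 1 [gegenSum_eq_sum_range (N := n + 2) (by lia)]
    rw [Finset.sum_range_succ', gegenSum, Finset.mul_sum, add_sub_right_comm,
      ← Finset.sum_sub_distrib, pow_zero, mul_one, add_comm]
    congr 1
    refine Finset.sum_congr rfl fun k _ => ?_
    ring
  have h2 : (2 * (n : ℝ) + 1 + 2 * lam) *
      ∑ k ∈ Finset.range (n + 1), gegenCoeff lam 0 (n + 1) (k + 1) * y ^ (k + 1)
      = 2 * (2 * n + 1 + lam) * (∑ k ∈ Finset.range (n + 1),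
        (gegenCoeff lam 1 n (k + 1) - gegenCoeff lam 1 n k) * y ^ (k + 1))
        - (2 * n + 1) * ∑ k ∈ Finset.range (n + 1), gegenCoeff lam 0 n (k + 1) * y ^ (k + 1) := by
    rw [Finset.mul_sum, Finset.mul_sum, Finset.mul_sum, ← Finset.sum_sub_distrib]
    refine Finset.sum_congr rfl fun k _ => ?_
    linear_combination y ^ (k + 1) * gegenCoeff_even_recurrence hlam n k
  rw [mul_assoc, h1, gegenSum_eq_sum_range (N := n + 2) (by lia) (n := n), gegenSum,
    Finset.sum_range_succ' _ (n + 1), Finset.sum_range_succ' _ (n + 1), pow_zero]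
  linear_combination h2 + gegenCoeff_even_recurrence_zero lam n

theorem coeffA_zero (lam : ℝ) : coeffA lam 0 = 1 := by
  simp [coeffA, poch_zero]

theorem coeffB_zero {lam : ℝ} (h : lam ≠ 0) : coeffB lam 0 = 2 * lam := by
  simp [coeffB, poch_zero, h]

/-- `coeffA` and `coeffB` are the values C_m(1), with C_{m+1}(1)/C_m(1) = (m+2λ)/(m+1); here m = 2n,
and m = 2n + 1 in `coeffA_succ`. -/
theorem coeffB_eq {lam : ℝ} (h : lam ≠ 0) (n : ℕ) :
    (2 * n + 1) * coeffB lam n = (2 * n + 2 * lam) * coeffA lam n := by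
  have h1 := (poch_pos (a := 1) one_pos n).ne'
  have h2 := (poch_pos (a := 1 / 2) (by norm_num) n).ne'
  have h3 := (poch_pos (a := 3 / 2) (by norm_num) n).ne'
  have e1 : lam * poch (lam + 1) n = poch lam n * (lam + n) := by
    rw [← poch_succ_left, poch_succ]
  have e2 : (1 / 2 : ℝ) * poch (3 / 2) n = poch (1 / 2) n * (1 / 2 + n) := by
    rw [show (3 / 2 : ℝ) = 1 / 2 + 1 by norm_num, ← poch_succ_left, poch_succ]
  simp only [coeffA, coeffB, if_neg h]
  generalize poch (lam + 1 / 2) n = P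
  field_simp
  linear_combination P * (2 * n + 1) * poch (1 / 2) n * e1
    - 2 * P * poch lam n * (lam + n) * e2

theorem coeffA_succ {lam : ℝ} (h : lam ≠ 0) (n : ℕ) :
    (2 * n + 2) * coeffA lam (n + 1) = (2 * n + 1 + 2 * lam) * coeffB lam n := by
  have h1 := (poch_pos (a := 1) one_pos n).ne'
  have h3 := (poch_pos (a := 3 / 2) (by norm_num) n).ne'
  have h4 : (1 : ℝ) + n ≠ 0 := by positivity
  simp only [coeffA, coeffB, if_neg h]
  rw [poch_succ_left (1 / 2), poch_succ_left lam, poch_succ 1, poch_succ (lam + 1 / 2),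
    show (1 / 2 : ℝ) + 1 = 3 / 2 by norm_num]
  field_simp
  ring

theorem gegenbauerRec_eq {lam : ℝ} (hlam : -(1 / 2) < lam) (h0 : lam ≠ 0) (t : ℝ) (n : ℕ) :
    gegenbauerRec lam t (2 * n) = coeffA lam n * gegenSum lam 0 n (1 - t ^ 2) ∧
      gegenbauerRec lam t (2 * n + 1) = coeffB lam n * (t * gegenSum lam 1 n (1 - t ^ 2)) := by
  induction n with
  | zero => simp [gegenbauerRec, coeffA_zero, coeffB_zero h0, gegenSum_zero]
  | succ n ih =>
    obtain ⟨ihe, iho⟩ := ih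
    have he : gegenbauerRec lam t (2 * (n + 1))
        = coeffA lam (n + 1) * gegenSum lam 0 (n + 1) (1 - t ^ 2) := by
      have hS := gegenSum_even_recurrence hlam n (1 - t ^ 2)
      have hA := coeffA_succ h0 n
      have hB := coeffB_eq h0 n
      rw [show 2 * (n + 1) = 2 * n + 2 by ring, gegenbauerRec, ihe, iho,
        div_eq_iff (by positivity)]
      push_cast
      linear_combination (-gegenSum lam 0 (n + 1) (1 - t ^ 2)) * hA - coeffB lam n * hS
        + gegenSum lam 0 n (1 - t ^ 2) * hB
    refine ⟨he, ?_⟩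
    have hS := gegenSum_odd_recurrence lam n (1 - t ^ 2)
    have hA := coeffA_succ h0 n
    have hB := coeffB_eq h0 (n + 1)
    rw [show 2 * (n + 1) = 2 * n + 2 by ring] at he
    rw [show 2 * (n + 1) + 1 = (2 * n + 1) + 2 by ring, gegenbauerRec,
      show 2 * n + 1 + 1 = 2 * n + 2 by ring, he, iho, div_eq_iff (by positivity)]
    push_cast at hB hS ⊢
    linear_combination (-(t * gegenSum lam 1 (n + 1) (1 - t ^ 2))) * hB
      - t * coeffA lam (n + 1) * hS + t * gegenSum lam 1 n (1 - t ^ 2) * hA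

theorem chebyshev_eq (t : ℝ) (n : ℕ) :
    (Polynomial.Chebyshev.T ℝ ((2 * n : ℕ) : ℤ)).eval t = gegenSum 0 0 n (1 - t ^ 2) ∧
      (Polynomial.Chebyshev.T ℝ ((2 * n + 1 : ℕ) : ℤ)).eval t
        = t * gegenSum 0 1 n (1 - t ^ 2) := by
  have hT : ∀ m : ℕ, (Polynomial.Chebyshev.T ℝ ((m + 2 : ℕ) : ℤ)).eval t
      = 2 * t * (Polynomial.Chebyshev.T ℝ ((m + 1 : ℕ) : ℤ)).eval t
        - (Polynomial.Chebyshev.T ℝ (m : ℤ)).eval t := by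
    intro m
    push_cast
    rw [Polynomial.Chebyshev.T_add_two]
    simp
  induction n with
  | zero => simp [gegenSum_zero]
  | succ n ih =>
    obtain ⟨ihe, iho⟩ := ih
    have he : (Polynomial.Chebyshev.T ℝ ((2 * (n + 1) : ℕ) : ℤ)).eval t
        = gegenSum 0 0 (n + 1) (1 - t ^ 2) := by
      have hS := gegenSum_even_recurrence (lam := 0) (by norm_num) n (1 - t ^ 2)
      have hn : (2 * (n : ℝ) + 1) ≠ 0 := by positivity
      rw [show 2 * (n + 1) = 2 * n + 2 by ring, hT, ihe, iho]
      refine mul_left_cancel₀ hn ?_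
      linear_combination -hS
    refine ⟨he, ?_⟩
    have hS := gegenSum_odd_recurrence 0 n (1 - t ^ 2)
    have hn : (2 * ((n : ℝ) + 1)) ≠ 0 := by positivity
    rw [show 2 * (n + 1) + 1 = (2 * n + 1) + 2 by ring, hT,
      show 2 * n + 1 + 1 = 2 * (n + 1) by ring, he, iho]
    refine mul_left_cancel₀ hn ?_
    push_cast at hS
    linear_combination -t * hS

theorem gegenbauerC_eq {lam : ℝ} (hlam : -(1 / 2) < lam) (t : ℝ) (n : ℕ) :
    gegenbauerC lam (2 * n) t = coeffA lam n * gegenSum lam 0 n (1 - t ^ 2) ∧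
      gegenbauerC lam (2 * n + 1) t = coeffB lam n * (t * gegenSum lam 1 n (1 - t ^ 2)) := by
  by_cases h : lam = 0
  · subst h
    simpa [gegenbauerC, coeffA, coeffB] using chebyshev_eq t n
  · simpa only [gegenbauerC, if_neg h] using gegenbauerRec_eq hlam h t n

/-! ### Expansion of R_n into profiles and conclusion. -/

theorem one_sub_div_sqrt_sq (x : ℝ) : 1 - (x / √(1 + x ^ 2)) ^ 2 = (1 + x ^ 2)⁻¹ := by
  have h : 0 < 1 + x ^ 2 := by positivity
  rw [div_pow, Real.sq_sqrt h.le]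
  field_simp
  ring

theorem mmgf_even {lam : ℝ} (hlam : -(1 / 2) < lam) (n : ℕ) (x : ℝ) :
    mmgf lam (2 * n) x = coeffA lam n * ∑ k ∈ Finset.range (n + 1),
      gegenCoeff lam 0 n k * (1 + x ^ 2) ^ (-(k + (lam + 1) / 2)) := by
  have h : 0 < 1 + x ^ 2 := by positivity
  rw [mmgf, (gegenbauerC_eq hlam _ n).1, one_sub_div_sqrt_sq, gegenSum, mul_left_comm,
    Finset.mul_sum]
  congr 1
  refine Finset.sum_congr rfl fun k _ => ?_
  rw [neg_add, Real.rpow_add h, Real.rpow_neg h.le k, Real.rpow_natCast, inv_pow]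
  ring

theorem mmgf_odd {lam : ℝ} (hlam : -(1 / 2) < lam) (n : ℕ) (x : ℝ) :
    mmgf lam (2 * n + 1) x = coeffB lam n * ∑ k ∈ Finset.range (n + 1),
      gegenCoeff lam 1 n k * (x * (1 + x ^ 2) ^ (-(k + lam / 2 + 1))) := by
  have h : 0 < 1 + x ^ 2 := by positivity
  rw [mmgf, (gegenbauerC_eq hlam _ n).2, one_sub_div_sqrt_sq, gegenSum, mul_left_comm,
    Finset.mul_sum, Finset.mul_sum]
  congr 1
  refine Finset.sum_congr rfl fun k _ => ?_
  -- The additional exponent -1/2 comes from the factor t = x/√(1+x²).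
  rw [show -((k : ℝ) + lam / 2 + 1) = -((lam + 1) / 2) + -(k : ℝ) + -(1 / 2) by ring,
    Real.rpow_add h, Real.rpow_add h, Real.rpow_neg h.le k, Real.rpow_neg h.le (1 / 2),
    Real.rpow_natCast, inv_pow, ← Real.sqrt_eq_rpow]
  ring

theorem theorem3p2 (s lam : ℝ) (hs : 0 < s) (hlam : -(1 / 2) < lam) (n : ℕ) :
    HasFracLaplacian s (fun x => (mmgf lam (2 * n) x : ℂ))
      (fun x => ((coeffA lam n * ∑ k ∈ Finset.range (n + 1),
        poch (-(n : ℝ)) k * poch (n + lam) k / (poch (lam + 1 / 2) k * (k.factorial : ℝ))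
          * constA s (k + (lam + 1) / 2)
          * hyp2F1 (s + k + (lam + 1) / 2) (s + 1 / 2) (1 / 2) (-x ^ 2) : ℝ) : ℂ)) ∧
    HasFracLaplacian s (fun x => (mmgf lam (2 * n + 1) x : ℂ))
      (fun x => (((2 * s + 1) * coeffB lam n * x * ∑ k ∈ Finset.range (n + 1),
        poch (-(n : ℝ)) k * poch (n + lam + 1) k / (poch (lam + 1 / 2) k * (k.factorial : ℝ))
          * constA s (k + lam / 2 + 1)
          * hyp2F1 (s + k + lam / 2 + 1) (s + 3 / 2) (3 / 2) (-x ^ 2) : ℝ) : ℂ)) := by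
  constructor
  · have h := ((HasL1FracLaplacian.sum (s := s) (Finset.range (n + 1)) fun k _ =>
      (hasL1FracLaplacian_even (γ := k + (lam + 1) / 2) hs.le (by
        have : (0 : ℝ) ≤ k := k.cast_nonneg
        linarith)).const_mul (gegenCoeff lam 0 n k : ℂ)).const_mul
        (coeffA lam n : ℂ)).hasFracLaplacian
    convert h using 2 with x x
    · rw [mmgf_even hlam]
      push_cast
      rfl
    · push_cast
      simp only [gegenCoeff, add_zero, add_assoc, mul_assoc]
      push_cast
      rfl
  · have h := ((HasL1FracLaplacian.sum (s := s) (Finset.range (n + 1)) fun k _ =>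
      (hasL1FracLaplacian_odd (γ := k + lam / 2 + 1) hs.le (by
        have : (0 : ℝ) ≤ k := k.cast_nonneg
        linarith)).const_mul (gegenCoeff lam 1 n k : ℂ)).const_mul
        (coeffB lam n : ℂ)).hasFracLaplacian
    convert h using 2 with x x
    · rw [mmgf_odd hlam]
      push_cast
      rfl
    · simp only [← Complex.ofReal_mul, ← Complex.ofReal_sum]
      congr 1
      rw [Finset.mul_sum, Finset.mul_sum]
      refine Finset.sum_congr rfl fun k _ => ?_
      rw [gegenCoeff, show s + k + lam / 2 + 1 = s + (k + lam / 2 + 1) by ring]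
      ring
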